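/- Let $d\ge 1$, $\varepsilon>0$ and $\mu>0$. For $u=(u_j)_{j\in\mathbb Z^d}$ let $(\Delta_d u)_j=\sum_{k=1}^d(u_{j+e_k}-2u_j+u_{j-e_k})$ be the discrete Laplacian, where $e_1,\dots,e_d$ are the coordinate vectors. For $R\in\mathbb R$, $j\in\mathbb Z^d$ and $t\in[0,1]$ put $$W_j(t)=\exp\Big(\mu\,|j+Rt(1-t)e_1|^2-\frac{(1+\varepsilon)R^2t(1-t)}{16\mu}\Big),$$ where $|\cdot|$ is the Euclidean norm, and write $\|F\|_{L^2([0,1],\ell^2(\mathbb Z^d))}=\big(\int_0^1\sum_{j\in\mathbb Z^d}|F_j(t)|^2\,dt\big)^{1/2}$. Then there is $R_0=R_0(d,\varepsilon,\mu)$ such that for every $R\ge R_0$ $$R\sqrt{\frac{\varepsilon}{8\mu}}\;\|W g\|_{L^2([0,1],\ell^2(\mathbb Z^d))}\le\|W(\partial_t-i\Delta_d)g\|_{L^2([0,1],\ell^2(\mathbb Z^d))}$$ for all $g=(g_j)_{j\in\mathbb Z^d}$ such that each $g_j:[0,1]\to\mathbb C$ is $C^\infty$ on $[0,1]$ with $g_j(0)=g_j(1)=0$,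 and $g_j\equiv0$ for all but finitely many $j$. In particular, this holds for all $g\in C_0^\infty(\mathbb Z^d\times(0,1))$. -/

import Mathlib

open scoped ContDiff

namespace DiscreteCarleman

/-- The discrete Laplacian on the lattice `ℤ^d`:
`(Δ_d u)_j = ∑ₖ (u_{j + eₖ} - 2 u_j + u_{j - eₖ})`. -/
noncomputable def discreteLaplacian {d : ℕ} (u : (Fin d → ℤ) → ℂ) (j : Fin d → ℤ) : ℂ :=
  ∑ k : Fin d, (u (j + Pi.single k 1) - 2 * u j + u (j - Pi.single k 1))

/-- `((∂_t - i Δ_d) g)_j(t)` for a family `g` of functions on the time interval `[0,1]`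
(the time derivative is one-sided at the two endpoints). -/
noncomputable def schrodingerOp {d : ℕ} (g : (Fin d → ℤ) → ℝ → ℂ) (j : Fin d → ℤ) (t : ℝ) : ℂ :=
  derivWithin (g j) (Set.Icc 0 1) t - Complex.I * discreteLaplacian (fun m => g m t) j

/-- The weight `exp (μ |j + R t (1 - t) e₁|² - (1 + ε) R² t (1 - t) / (16 μ))`, where `|·|` is the
Euclidean norm on `ℝ^d` and `e₁` is the first coordinate vector (index `0` of `Fin d`). -/
noncomputable def carlemanWeight {d : ℕ} [NeZero d] (ε μ R : ℝ) (j : Fin d → ℤ) (t : ℝ) : ℝ :=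
  Real.exp (μ * ∑ k : Fin d,
      ((j k : ℝ) + R * t * (1 - t) * (Pi.single (0 : Fin d) (1 : ℝ) : Fin d → ℝ) k) ^ 2
    - (1 + ε) * R ^ 2 * t * (1 - t) / (16 * μ))

/-- The norm of `L²([0,1], ℓ²(ℤ^d))`, that is `(∫₀¹ ∑_j |F_j(t)|² dt)^{1/2}`. It is applied only to
families that are continuous in `t ∈ [0,1]` and vanish on `[0,1]` for all but finitely many `j`,
where the sum is finite and the integrand is continuous. -/
noncomputable def normL2 {d : ℕ} (F : (Fin d → ℤ) → ℝ → ℂ) : ℝ :=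
  Real.sqrt (∫ t in (0 : ℝ)..1, ∑' j : Fin d → ℤ, ‖F j t‖ ^ 2)

/-- The test functions on `ℤ^d × [0,1]`: smooth in `t ∈ [0,1]`, nonzero at only finitely many
lattice points `j` (compact support), and zero at the two ends `t = 0` and `t = 1`. -/
structure IsTestFunction {d : ℕ} (g : (Fin d → ℤ) → ℝ → ℂ) : Prop where
  smooth : ∀ j, ContDiffOn ℝ ∞ (g j) (Set.Icc 0 1)
  finite_support : {j | ∃ t ∈ Set.Icc (0 : ℝ) 1, g j t ≠ 0}.Finite
  zero_left : ∀ j, g j 0 = 0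
  zero_right : ∀ j, g j 1 = 0

end DiscreteCarleman

/-! Put `f = W g`. Conjugating `∂_t - iΔ_d` by the weight gives `A + S`, with `A = ∂_t - i ∑ (C_k -
2)` antisymmetric and `S = -p + i ∑ D_k` symmetric. Here `p` is the time derivative of the exponent
of `W`, `θ_k` is its increment along an edge in direction `k`, and `C_k`, `D_k` are the
nearest-neighbour operators with edge weights `cosh θ_k` and `sinh θ_k`. Then `‖(A + S) f‖² ≥ 2 Re
⟨A f, S f⟩`, and this cross term is the time derivative of `⟨S f, f⟩` plus commutator terms. As `f`
vanishes at both ends of `[0,1]`, it remains to bound the commutator terms below by `ε R² / (8μ)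
‖f‖²`.

With `y` the first coordinate of `j + R t (1 - t) e₁` and `X = R (1 - 2t)`, these terms contain the
diagonal `4 sinh(2μ) sinh²(2μy) + 2μX² - 4μRy + (1 + ε) R² / (8μ)` and an edge term of size `8μ X
cosh θ`. The part `8μ sinh²(2μy) + 2μX² + 8μR` of the diagonal absorbs the edge term
(`edge_nonneg`). As `sinh(2μ) > 2μ`, a positive multiple of `sinh²(2μy)` is left, which together
with `R² / (8μ)` pays for `-4μRy - 8μR` once `R` is large (`exists_forall_diagonal_nonneg`). The
surplus `ε R² / (8μ)` is the claimed gain. -/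

namespace DiscreteCarleman

open scoped ComplexConjugate

/-! ### Summation by parts and commutators of nearest-neighbour operators. -/

section

/-- The sum of a function over a finite set is invariant under a shift if both the function and its
shift vanish outside the set. -/
theorem sum_shift {G M : Type*} [AddGroup G] [AddCommMonoid M] (K : Finset G) (F : G → M) (e : G)
    (h : ∀ j ∉ K, F j = 0) (h' : ∀ j ∉ K, F (j + e) = 0) :
    ∑ j ∈ K, F (j + e) = ∑ j ∈ K, F j := by
  rw [← finsum_eq_sum_of_support_subset (s := K) (fun j => F (j + e)),
    ← finsum_eq_sum_of_support_subset (s := K) F]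
  · exact finsum_comp_equiv (Equiv.addRight e) (f := F)
  · intro j hj; by_contra hK; exact hj (h j hK)
  · intro j hj; by_contra hK; exact hj (h' j hK)

/-- `u` vanishes at all points outside `K` and at their nearest neighbours. -/
structure SupportedWithin {d : ℕ} (K : Finset (Fin d → ℤ)) (u : (Fin d → ℤ) → ℂ) : Prop where
  self : ∀ j ∉ K, u j = 0
  right : ∀ j ∉ K, ∀ k, u (j + Pi.single k 1) = 0
  left : ∀ j ∉ K, ∀ k, u (j - Pi.single k 1) = 0

variable {d : ℕ} {K : Finset (Fin d → ℤ)} {u v : (Fin d → ℤ) → ℂ}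

/-- The symmetric nearest-neighbour operator with edge weights `c` in direction `k`. -/
noncomputable def symHop (c : (Fin d → ℤ) → ℝ) (k : Fin d) (u : (Fin d → ℤ) → ℂ)
    (j : Fin d → ℤ) : ℂ :=
  c j * u (j + Pi.single k 1) + c (j - Pi.single k 1) * u (j - Pi.single k 1)

/-- The antisymmetric nearest-neighbour operator with edge weights `s` in direction `k`. -/
noncomputable def skewHop (s : (Fin d → ℤ) → ℝ) (k : Fin d) (u : (Fin d → ℤ) → ℂ)
    (j : Fin d → ℤ) : ℂ :=
  s j * u (j + Pi.single k 1) - s (j - Pi.single k 1) * u (j - Pi.single k 1)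

theorem sum_re_conj_mul_I_skewHop (hu : SupportedWithin K u) (hv : SupportedWithin K v)
    (s : (Fin d → ℤ) → ℝ) (k : Fin d) :
    ∑ j ∈ K, (conj (v j) * (Complex.I * skewHop s k u j)).re =
      ∑ j ∈ K, -(s j * ((conj (v j) * u (j + Pi.single k 1)).im +
        (conj (u j) * v (j + Pi.single k 1)).im)) := by
  have := sum_shift K (fun j => s (j - Pi.single k 1) * (conj (v j) * u (j - Pi.single k 1)).im)
    (Pi.single k 1) (fun j hj => by simp [hv.self j hj]) (fun j hj => by simp [hu.self j hj])
  rw [← sub_eq_zero, ← Finset.sum_sub_distrib]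
  rw [← sub_eq_zero, ← Finset.sum_sub_distrib, ← neg_eq_zero, ← Finset.sum_neg_distrib] at this
  rw [← this]
  refine Finset.sum_congr rfl fun j _ => ?_
  simp [skewHop]
  ring

/-- Real edge weights make the operator antisymmetric. This removes the pairing of `D_k` with the
diagonal part `-2u` of the Laplacian. -/
theorem sum_re_conj_mul_skewHop (hu : SupportedWithin K u) (s : (Fin d → ℤ) → ℝ) (k : Fin d) :
    ∑ j ∈ K, (conj (u j) * skewHop s k u j).re = 0 := by
  have := sum_shift K (fun j => s (j - Pi.single k 1) * (conj (u j) * u (j - Pi.single k 1)).re)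
    (Pi.single k 1) (fun j hj => by simp [hu.self j hj]) (fun j hj => by simp [hu.self j hj])
  rw [← sub_eq_zero, ← Finset.sum_sub_distrib] at this
  rw [← this]
  refine Finset.sum_congr rfl fun j _ => ?_
  simp [skewHop]
  ring

/-- This is the commutator of `C_k` with multiplication by `p`, so only the increment of `p` along
the edge survives. -/
theorem sum_re_conj_symHop_mul (hu : SupportedWithin K u) (c p : (Fin d → ℤ) → ℝ) (k : Fin d) :
    ∑ j ∈ K, (conj (-Complex.I * symHop c k u j) * (-(p j * u j))).re =
      ∑ j ∈ K, (p (j + Pi.single k 1) - p j) * c j * (conj (u j) * u (j + Pi.single k 1)).im := by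
  have := sum_shift K
    (fun j => p j * c (j - Pi.single k 1) * (conj (u (j - Pi.single k 1)) * u j).im)
    (Pi.single k 1) (fun j hj => by simp [hu.self j hj]) (fun j hj => by simp [hu.self j hj])
  rw [← sub_eq_zero, ← Finset.sum_sub_distrib]
  rw [← sub_eq_zero, ← Finset.sum_sub_distrib, ← neg_eq_zero, ← Finset.sum_neg_distrib] at this
  rw [← this]
  refine Finset.sum_congr rfl fun j _ => ?_
  simp [symHop]
  ring

/-- The product has four corner terms. They cancel in opposite pairs after shifts by `e_k + e_l` and
`e_l - e_k`, since each weight is constant in the other's direction. -/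
theorem sum_re_conj_symHop_mul_skewHop_of_ne (hu : SupportedWithin K u)
    {c s : (Fin d → ℤ) → ℝ} {k l : Fin d}
    (hc : ∀ j, c (j + Pi.single l 1) = c j) (hs : ∀ j, s (j + Pi.single k 1) = s j) :
    ∑ j ∈ K, (conj (symHop c k u j) * skewHop s l u j).re = 0 := by
  have hc' : ∀ j, c (j - Pi.single l 1) = c j := fun j => by
    rw [← hc (j - Pi.single l 1), sub_add_cancel]
  have hs' : ∀ j, s (j - Pi.single k 1) = s j := fun j => by
    rw [← hs (j - Pi.single k 1), sub_add_cancel]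
  have h₁ := sum_shift K (fun j => c (j - Pi.single k 1) * s (j - Pi.single l 1) *
      (conj (u (j - Pi.single k 1)) * u (j - Pi.single l 1)).re)
    (Pi.single k 1 + Pi.single l 1) (fun j hj => by simp [hu.left j hj])
    (fun j hj => by
      rw [show j + (Pi.single k 1 + Pi.single l 1) - Pi.single k 1 = j + Pi.single l 1 by abel]
      simp [hu.right j hj])
  have h₂ := sum_shift K (fun j => c j * s (j - Pi.single l 1) *
      (conj (u (j + Pi.single k 1)) * u (j - Pi.single l 1)).re)
    (Pi.single l 1 - Pi.single k 1) (fun j hj => by simp [hu.right j hj])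
    (fun j hj => by
      rw [show j + (Pi.single l 1 - Pi.single k 1) + Pi.single k 1 = j + Pi.single l 1 by abel]
      simp [hu.right j hj])
  rw [← sub_eq_zero, ← Finset.sum_sub_distrib] at h₁ h₂
  rw [← add_zero (0 : ℝ)]
  nth_rewrite 2 [← h₁]
  rw [← h₂, ← Finset.sum_add_distrib]
  refine Finset.sum_congr rfl fun j _ => ?_
  rw [show j + (Pi.single k 1 + Pi.single l 1) - Pi.single k 1 = j + Pi.single l 1 by abel,
    show j + (Pi.single k 1 + Pi.single l 1) - Pi.single l 1 = j + Pi.single k 1 by abel,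
    show j + (Pi.single l 1 - Pi.single k 1) + Pi.single k 1 = j + Pi.single l 1 by abel,
    show j + (Pi.single l 1 - Pi.single k 1) - Pi.single l 1 = j - Pi.single k 1 by abel,
    show j + (Pi.single l 1 - Pi.single k 1) = j - Pi.single k 1 + Pi.single l 1 by abel,
    hc, hc, hs, hs']
  simp [skewHop, symHop]
  ring

/-- Lower bound for the commutator of the two nearest-neighbour operators in one direction, when the
edge weights are `cosh θ` and `sinh θ` with `θ` of slope `2 μ`. -/
theorem le_sum_re_conj_symHop_mul_skewHop (hu : SupportedWithin K u) {μ : ℝ} (hμ : 0 ≤ μ)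
    {θ : (Fin d → ℤ) → ℝ} {k : Fin d} (hθ : ∀ j, θ (j + Pi.single k 1) = θ j + 2 * μ) :
    ∑ j ∈ K, 2 * Real.sinh (2 * μ) * Real.sinh (θ j - μ) ^ 2 * ‖u j‖ ^ 2 ≤
      -∑ j ∈ K, (conj (symHop (fun j => Real.cosh (θ j)) k u j) *
        skewHop (fun j => Real.sinh (θ j)) k u j).re := by
  have hθ' : ∀ j, θ (j - Pi.single k 1) = θ j - 2 * μ := fun j => by
    have := hθ (j - Pi.single k 1)
    rw [sub_add_cancel] at this
    linarith
  have hsh : 0 ≤ Real.sinh (2 * μ) := Real.sinh_nonneg_iff.2 (by linarith)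
  have h₁ := sum_shift K (fun j => Real.cosh (θ j - 2 * μ) * Real.sinh (θ j - 2 * μ) * ‖u j‖ ^ 2)
    (Pi.single k 1) (fun j hj => by simp [hu.self j hj]) (fun j hj => by simp [hu.right j hj])
  have h₂ := sum_shift K (fun j => Real.cosh (θ j) * Real.sinh (θ j) * ‖u j‖ ^ 2)
    (-Pi.single k 1) (fun j hj => by simp [hu.self j hj])
    (fun j hj => by simp [← sub_eq_add_neg, hu.left j hj])
  have h₃ := sum_shift K (fun j => ‖u j‖ ^ 2 * Real.sinh (2 * μ))
    (Pi.single k 1) (fun j hj => by simp [hu.self j hj]) (fun j hj => by simp [hu.right j hj])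
  have h₄ := sum_shift K (fun j => ‖u j‖ ^ 2 * Real.sinh (2 * μ))
    (-Pi.single k 1) (fun j hj => by simp [hu.self j hj])
    (fun j hj => by simp [← sub_eq_add_neg, hu.left j hj])
  simp only [hθ, ← sub_eq_add_neg, hθ', add_sub_cancel_right] at h₁ h₂ h₃ h₄
  -- The added differences sum to zero over `K` by the shifts above; they make the inequality true
  -- site by site.
  suffices h : ∑ j ∈ K, (2 * Real.sinh (2 * μ) * Real.sinh (θ j - μ) ^ 2 * ‖u j‖ ^ 2
      + (conj (symHop (fun j => Real.cosh (θ j)) k u j) *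
        skewHop (fun j => Real.sinh (θ j)) k u j).re
      + (Real.cosh (θ j - 2 * μ) * Real.sinh (θ j - 2 * μ) * ‖u (j - Pi.single k 1)‖ ^ 2
        - Real.cosh (θ j) * Real.sinh (θ j) * ‖u j‖ ^ 2)
      - (Real.cosh (θ j) * Real.sinh (θ j) * ‖u (j + Pi.single k 1)‖ ^ 2
        - Real.cosh (θ j - 2 * μ) * Real.sinh (θ j - 2 * μ) * ‖u j‖ ^ 2)
      - (‖u (j + Pi.single k 1)‖ ^ 2 * Real.sinh (2 * μ) - ‖u j‖ ^ 2 * Real.sinh (2 * μ)) / 2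
      - (‖u (j - Pi.single k 1)‖ ^ 2 * Real.sinh (2 * μ) - ‖u j‖ ^ 2 * Real.sinh (2 * μ)) / 2)
      ≤ 0 by
    simp only [Finset.sum_add_distrib, Finset.sum_sub_distrib, ← Finset.sum_div] at h
    linarith
  refine Finset.sum_nonpos fun j _ => ?_
  have e₁ : (conj (symHop (fun j => Real.cosh (θ j)) k u j) *
        skewHop (fun j => Real.sinh (θ j)) k u j).re =
      Real.cosh (θ j) * Real.sinh (θ j) * ‖u (j + Pi.single k 1)‖ ^ 2
      - Real.cosh (θ j - 2 * μ) * Real.sinh (θ j - 2 * μ) * ‖u (j - Pi.single k 1)‖ ^ 2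
      + Real.sinh (θ j - (θ j - 2 * μ)) *
        (conj (u (j - Pi.single k 1)) * u (j + Pi.single k 1)).re := by
    rw [Real.sinh_sub (θ j) (θ j - 2 * μ)]
    simp only [symHop, skewHop, hθ', Complex.sq_norm, Complex.normSq_apply]
    generalize Real.cosh (θ j) = c, Real.sinh (θ j) = s, Real.cosh (θ j - 2 * μ) = c',
      Real.sinh (θ j - 2 * μ) = s'
    simp
    ring
  -- Both sides equal `sinh(2μ) (cosh(2(θ - μ)) - 1)`; the `-1` is the loss from `e₃`.
  have e₂ : 2 * Real.sinh (2 * μ) * Real.sinh (θ j - μ) ^ 2 =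
      Real.cosh (θ j) * Real.sinh (θ j) - Real.cosh (θ j - 2 * μ) * Real.sinh (θ j - 2 * μ)
      - Real.sinh (2 * μ) := by
    have a₁ : θ j = (θ j - μ) + μ := by ring
    have a₂ : θ j - 2 * μ = (θ j - μ) - μ := by ring
    rw [a₂, Real.sinh_sub (θ j - μ) μ, Real.cosh_sub (θ j - μ) μ]
    nth_rewrite 2 3 [a₁]
    rw [Real.sinh_add (θ j - μ) μ, Real.cosh_add (θ j - μ) μ, Real.sinh_two_mul]
    have h₁ := Real.cosh_sq (θ j - μ)
    have h₂ := Real.cosh_sq μ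
    generalize Real.cosh (θ j - μ) = C at *
    generalize Real.sinh (θ j - μ) = S at *
    linear_combination (-2 * Real.sinh μ * Real.cosh μ) * h₁
  have e₃ : -2 * (conj (u (j - Pi.single k 1)) * u (j + Pi.single k 1)).re ≥
      -(‖u (j + Pi.single k 1)‖ ^ 2 + ‖u (j - Pi.single k 1)‖ ^ 2) := by
    simp only [Complex.sq_norm, Complex.normSq_apply]
    simp
    nlinarith [sq_nonneg ((u (j - Pi.single k 1)).re - (u (j + Pi.single k 1)).re),
      sq_nonneg ((u (j - Pi.single k 1)).im - (u (j + Pi.single k 1)).im)]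
  rw [e₁, e₂, sub_sub_cancel]
  nlinarith [mul_le_mul_of_nonneg_left e₃ hsh]

end

/-! ### Lower bound for the conjugated operator at a fixed time. -/

section

variable {d : ℕ} {K : Finset (Fin d → ℤ)} {u v : (Fin d → ℤ) → ℂ}

theorem two_mul_re_conj_mul_le_sq_norm_add (a b : ℂ) : 2 * (conj a * b).re ≤ ‖a + b‖ ^ 2 := by
  simp only [Complex.sq_norm, Complex.normSq_apply]
  simp
  nlinarith [sq_nonneg a.re, sq_nonneg a.im, sq_nonneg b.re, sq_nonneg b.im]

/-- The fixed-time form of the Carleman estimate: the square norm of the sum of the antisymmetric and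
the symmetric part of the conjugated operator dominates the cross term. -/
theorem le_sum_sq_norm_conjugated (hu : SupportedWithin K u) (hv : SupportedWithin K v)
    {μ : ℝ} (hμ : 0 ≤ μ) {θ : Fin d → (Fin d → ℤ) → ℝ} (p : (Fin d → ℤ) → ℝ)
    (hθ : ∀ k j, θ k (j + Pi.single k 1) = θ k j + 2 * μ)
    (hθ' : ∀ k l j, k ≠ l → θ k (j + Pi.single l 1) = θ k j) :
    ∑ j ∈ K, (-2 * p j * (conj (u j) * v j).re + ∑ k, (
        -2 * (Real.sinh (θ k j) * ((conj (v j) * u (j + Pi.single k 1)).im +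
          (conj (u j) * v (j + Pi.single k 1)).im))
        + 4 * Real.sinh (2 * μ) * Real.sinh (θ k j - μ) ^ 2 * ‖u j‖ ^ 2
        + 2 * ((p (j + Pi.single k 1) - p j) * Real.cosh (θ k j) *
          (conj (u j) * u (j + Pi.single k 1)).im))) ≤
      ∑ j ∈ K, ‖v j - Complex.I * ∑ k, (symHop (fun j => Real.cosh (θ k j)) k u j - 2 * u j) +
        (-(p j * u j) + Complex.I * ∑ k, skewHop (fun j => Real.sinh (θ k j)) k u j)‖ ^ 2 := by
  set C := fun k => symHop (fun j => Real.cosh (θ k j)) k u with hC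
  set D := fun k => skewHop (fun j => Real.sinh (θ k j)) k u with hD
  -- The last sum, with factor `2 d`, comes from the diagonal terms `-2u`; it vanishes after
  -- summation over `K`.
  have key : ∀ j, 2 * ((conj (v j) * (-(p j * u j))).re
      + ∑ k, (conj (v j) * (Complex.I * D k j)).re
      + ∑ k, (conj (-Complex.I * C k j) * (-(p j * u j))).re
      - ∑ k, ∑ l, (conj (C k j) * D l j).re
      + 2 * d * ∑ k, (conj (u j) * D k j).re) ≤
      ‖v j - Complex.I * ∑ k, (C k j - 2 * u j) +
        (-(p j * u j) + Complex.I * ∑ k, D k j)‖ ^ 2 := by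
    intro j
    refine le_trans (le_of_eq ?_) (two_mul_re_conj_mul_le_sq_norm_add _ _)
    simp only [← Complex.re_sum, ← Finset.mul_sum, ← Finset.sum_mul, ← map_sum,
      Finset.sum_sub_distrib, Finset.sum_const, Finset.card_univ, Fintype.card_fin, nsmul_eq_mul]
    generalize ∑ k, C k j = X, ∑ k, D k j = Y
    simp
    ring
  refine le_trans ?_ (Finset.sum_le_sum fun j _ => key j)
  have h₁ := fun k => sum_re_conj_mul_I_skewHop hu hv (fun j => Real.sinh (θ k j)) k
  have h₂ := fun k => sum_re_conj_mul_skewHop hu (fun j => Real.sinh (θ k j)) k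
  have h₃ := fun k => sum_re_conj_symHop_mul hu (fun j => Real.cosh (θ k j)) p k
  have h₄ : ∀ k l, k ≠ l → ∑ j ∈ K, (conj (C k j) * D l j).re = 0 := fun k l hkl =>
    sum_re_conj_symHop_mul_skewHop_of_ne hu (fun j => by rw [hθ' k l j hkl])
      (fun j => by rw [hθ' l k j hkl.symm])
  have h₅ := fun k => le_sum_re_conj_symHop_mul_skewHop hu hμ (hθ k)
  have h₆ : ∑ j ∈ K, ∑ k, ∑ l, (conj (C k j) * D l j).re =
      ∑ k, ∑ j ∈ K, (conj (C k j) * D k j).re := by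
    rw [Finset.sum_comm]
    refine Finset.sum_congr rfl fun k _ => ?_
    rw [Finset.sum_comm]
    exact Finset.sum_eq_single k (fun l _ hl => h₄ k l hl.symm) (by simp)
  have h₇ := Finset.sum_le_sum fun k (_ : k ∈ Finset.univ) => h₅ k
  rw [Finset.sum_neg_distrib] at h₇
  rw [← Finset.mul_sum]
  simp only [Finset.sum_add_distrib, Finset.sum_sub_distrib]
  rw [h₆, ← Finset.mul_sum]
  simp only [Finset.sum_comm (s := K) (t := Finset.univ), hC, hD, h₁, h₂, h₃, Finset.sum_const_zero]
  have e₁ : ∑ j ∈ K, -2 * p j * (conj (u j) * v j).re =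
      2 * ∑ j ∈ K, (conj (v j) * (-(p j * u j))).re := by
    rw [Finset.mul_sum]
    refine Finset.sum_congr rfl fun j _ => ?_
    simp
    ring
  rw [e₁]
  simp only [← Finset.mul_sum, Finset.sum_neg_distrib, mul_assoc] at h₇ ⊢
  linarith

end

/-! ### Absorption of the error terms by the diagonal. -/

section

theorem sq_le_sinh_sq (x : ℝ) : x ^ 2 ≤ Real.sinh x ^ 2 := by
  rw [sq_le_sq]
  rcases le_total 0 x with h | h
  · rw [abs_of_nonneg h, abs_of_nonneg (Real.sinh_nonneg_iff.2 h)]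
    exact Real.self_le_sinh_iff.2 h
  · rw [abs_of_nonpos h, abs_of_nonpos (Real.sinh_nonpos_iff.2 h)]
    exact neg_le_neg (Real.sinh_le_self_iff.2 h)

/-- Follows from `sinh² = cosh² - 1 ≥ (cosh - 1)²` and `cosh x - 1 ≥ x²/2`. Quartic growth beats a
quadratic however small its coefficient, which matters because `4 sinh(2μ) - 8μ` is small for small
`μ`. -/
theorem pow_four_div_four_le_sinh_sq (x : ℝ) : x ^ 4 / 4 ≤ Real.sinh x ^ 2 := by
  have h := sq_le_sinh_sq (x / 2)
  have h₁ := Real.cosh_sq x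
  have h₂ : Real.cosh x = 1 + 2 * Real.sinh (x / 2) ^ 2 := by
    have := Real.cosh_two_mul (x / 2)
    rw [Real.cosh_sq, mul_div_cancel₀ x two_ne_zero] at this
    linarith
  have h₃ : x ^ 2 / 2 ≤ Real.cosh x - 1 := by rw [h₂]; linarith
  nlinarith [sq_nonneg x, mul_self_le_mul_self (by positivity) h₃]

/-- For large `R`, the excess of the diagonal terms is nonnegative. -/
theorem exists_forall_diagonal_nonneg {μ : ℝ} (hμ : 0 < μ) :
    ∃ R₀ : ℝ, ∀ R, R₀ ≤ R → 0 ≤ R ∧ ∀ y : ℝ,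
      0 ≤ R ^ 2 / (8 * μ) + (4 * Real.sinh (2 * μ) - 8 * μ) * Real.sinh (2 * μ * y) ^ 2
        - 4 * μ * R * y - 8 * μ * R := by
  have hδ : 0 < 4 * Real.sinh (2 * μ) - 8 * μ := by
    linarith [Real.self_lt_sinh_iff.2 (show 0 < 2 * μ by positivity)]
  set δ := 4 * Real.sinh (2 * μ) - 8 * μ
  -- The threshold is what `h₄` needs: half of `R² / (8μ)` must absorb `8μR` and the constant from
  -- `h₂`. It depends on `μ` only.
  refine ⟨max 1 (16 * μ * (8 * μ + 256 * μ ^ 2 / δ)), fun R hR => ?_⟩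
  have hR₁ : 1 ≤ R := (le_max_left _ _).trans hR
  have hR₂ := (le_max_right _ _).trans hR
  refine ⟨by linarith, fun y => ?_⟩
  have hC : 0 ≤ 256 * μ ^ 2 / δ := by positivity
  have h₁ : 4 * μ * R * y ≤ R ^ 2 / (16 * μ) + 64 * μ ^ 3 * y ^ 2 := by
    rw [← sub_nonneg]
    have : R ^ 2 / (16 * μ) + 64 * μ ^ 3 * y ^ 2 - 4 * μ * R * y =
        (R - 32 * μ ^ 2 * y) ^ 2 / (16 * μ) := by field_simp; ring
    rw [this]; positivity
  have h₂ : 64 * μ ^ 3 * y ^ 2 ≤ δ * ((2 * μ * y) ^ 4 / 4) + 256 * μ ^ 2 / δ := by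
    rw [← sub_nonneg]
    have : δ * ((2 * μ * y) ^ 4 / 4) + 256 * μ ^ 2 / δ - 64 * μ ^ 3 * y ^ 2 =
        (2 * δ * μ ^ 2 * y ^ 2 - 16 * μ) ^ 2 / δ := by field_simp; ring
    rw [this]; positivity
  have h₃ := mul_le_mul_of_nonneg_left (pow_four_div_four_le_sinh_sq (2 * μ * y)) hδ.le
  have h₄ : 8 * μ * R + 256 * μ ^ 2 / δ ≤ R ^ 2 / (16 * μ) := by
    rw [le_div_iff₀ (by positivity)]
    nlinarith [mul_le_mul_of_nonneg_right hR₂ (show 0 ≤ R by linarith),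
      mul_nonneg (mul_nonneg hμ.le hC) (sub_nonneg.2 hR₁)]
  have h₅ : R ^ 2 / (8 * μ) = R ^ 2 / (16 * μ) + R ^ 2 / (16 * μ) := by field_simp; norm_num
  linarith

/-- The diagonal terms at the two ends of an edge absorb the cross term on the edge. -/
theorem edge_nonneg (μ : ℝ) {X e : ℝ} (he : 4 * |X| ≤ e) (θ : ℝ) (z w : ℂ) :
    0 ≤ (4 * Real.sinh (θ - μ) ^ 2 + X ^ 2 + e) * ‖z‖ ^ 2 +
      (4 * Real.sinh (θ + μ) ^ 2 + X ^ 2 + e) * ‖w‖ ^ 2 +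
      8 * X * Real.cosh θ * (conj z * w).im := by
  have he₀ : 0 ≤ e := (by positivity : 0 ≤ 4 * |X|).trans he
  have him : |(conj z * w).im| ≤ ‖z‖ * ‖w‖ := by
    simpa using Complex.abs_im_le_norm (conj z * w)
  have hsum : 2 * |Real.sinh θ| ≤ |Real.sinh (θ - μ)| + |Real.sinh (θ + μ)| := by
    have : Real.sinh (θ - μ) + Real.sinh (θ + μ) = 2 * Real.sinh θ * Real.cosh μ := by
      rw [Real.sinh_sub, Real.sinh_add]; ring
    refine le_trans ?_ (abs_add_le _ _)
    rw [this, abs_mul, abs_mul, abs_two, abs_of_pos (Real.cosh_pos _)]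
    exact le_mul_of_one_le_right (by positivity) (Real.one_le_cosh μ)
  -- The `1` costs `4 |X|` in `hmid`, which is what `e` is there to pay.
  have hcosh : Real.cosh θ ≤ |Real.sinh θ| + 1 := by
    refine abs_le_of_sq_le_sq' ?_ (by positivity) |>.2
    rw [Real.cosh_sq]
    nlinarith [sq_abs (Real.sinh θ), abs_nonneg (Real.sinh θ)]
  set a := |Real.sinh (θ - μ)| with ha
  set b := |Real.sinh (θ + μ)| with hb
  have ha' : Real.sinh (θ - μ) ^ 2 = a ^ 2 := (sq_abs _).symm
  have hb' : Real.sinh (θ + μ) ^ 2 = b ^ 2 := (sq_abs _).symm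
  have ha₀ : 0 ≤ a := abs_nonneg _
  have hb₀ : 0 ≤ b := abs_nonneg _
  rw [ha', hb', ← sq_abs X]
  have hX₀ : 0 ≤ |X| := abs_nonneg X
  have hcross : -(8 * |X| * Real.cosh θ * (‖z‖ * ‖w‖)) ≤ 8 * X * Real.cosh θ * (conj z * w).im := by
    refine le_trans (neg_le_neg ?_) (neg_abs_le _)
    rw [abs_mul, abs_mul, abs_mul, abs_of_pos (Real.cosh_pos _), abs_of_nonneg (by norm_num : (0 : ℝ) ≤ 8)]
    have := Real.cosh_pos θ
    gcongr
  set Y := |X|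
  have hmid : 4 * Y * Real.cosh θ ≤ 2 * a * Y + 2 * b * Y + e := by
    nlinarith [mul_le_mul_of_nonneg_left hcosh hX₀, mul_le_mul_of_nonneg_left hsum hX₀]
  -- After `hmid` this is Cauchy–Schwarz for `(2a, Y, √e)` and `(Y, 2b, √e)`.
  have hprod : (4 * Y * Real.cosh θ) ^ 2 ≤ (4 * a ^ 2 + Y ^ 2 + e) * (4 * b ^ 2 + Y ^ 2 + e) := by
    have := Real.cosh_pos θ
    refine (pow_le_pow_left₀ (by positivity) hmid 2).trans ?_
    nlinarith [sq_nonneg (4 * a * b - Y ^ 2), mul_nonneg he₀ (sq_nonneg (2 * a - Y)),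
      mul_nonneg he₀ (sq_nonneg (2 * b - Y))]
  have hA : 0 ≤ 4 * a ^ 2 + Y ^ 2 + e := by positivity
  have hB : 0 ≤ 4 * b ^ 2 + Y ^ 2 + e := by positivity
  set A := 4 * a ^ 2 + Y ^ 2 + e
  set B := 4 * b ^ 2 + Y ^ 2 + e
  have hsqrt : 4 * Y * Real.cosh θ ≤ √A * √B := by
    rw [← Real.sqrt_mul hA]
    exact Real.le_sqrt_of_sq_le hprod
  have hzw : 0 ≤ ‖z‖ * ‖w‖ := by positivity
  have := mul_le_mul_of_nonneg_right hsqrt hzw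
  nlinarith [sq_nonneg (√A * ‖z‖ - √B * ‖w‖), Real.sq_sqrt hA, Real.sq_sqrt hB]

variable {d : ℕ} {K : Finset (Fin d → ℤ)} {u v : (Fin d → ℤ) → ℂ}

/-- Each site is an end of two edges in direction `k`, so summing `edge_nonneg` uses the diagonal
twice; halving gives `4 X` in place of `8 X`. -/
theorem sum_edge_nonneg (hu : SupportedWithin K u) (μ : ℝ) {X e : ℝ} (he : 4 * |X| ≤ e)
    {θ : (Fin d → ℤ) → ℝ} {k : Fin d} (hθ : ∀ j, θ (j + Pi.single k 1) = θ j + 2 * μ) :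
    0 ≤ ∑ j ∈ K, ((4 * Real.sinh (θ j - μ) ^ 2 + X ^ 2 + e) * ‖u j‖ ^ 2 +
      4 * X * Real.cosh (θ j) * (conj (u j) * u (j + Pi.single k 1)).im) := by
  have h := sum_shift K (fun j => (4 * Real.sinh (θ j - μ) ^ 2 + X ^ 2 + e) * ‖u j‖ ^ 2)
    (Pi.single k 1) (fun j hj => by simp [hu.self j hj]) (fun j hj => by simp [hu.right j hj])
  have h' := Finset.sum_nonneg fun j (_ : j ∈ K) =>
    edge_nonneg μ he (θ j) (u j) (u (j + Pi.single k 1))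
  simp only [hθ, show ∀ x, x + 2 * μ - μ = x + μ from fun x => by ring] at h
  rw [Finset.sum_add_distrib, Finset.sum_add_distrib, h] at h'
  rw [Finset.sum_add_distrib]
  have : ∑ j ∈ K, 8 * X * Real.cosh (θ j) * (conj (u j) * u (j + Pi.single k 1)).im =
      2 * ∑ j ∈ K, 4 * X * Real.cosh (θ j) * (conj (u j) * u (j + Pi.single k 1)).im := by
    rw [Finset.mul_sum]
    exact Finset.sum_congr rfl fun j _ => by ring
  linarith

end

/-! ### The exponent of the weight and the quadratic form of the symmetric part. -/

section

/-- The coordinates of the point `j + R t (1 - t) e₁`. -/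
noncomputable def movedCoord {d : ℕ} [NeZero d] (R : ℝ) (j : Fin d → ℤ) (t : ℝ) (k : Fin d) : ℝ :=
  (j k : ℝ) + R * t * (1 - t) * (Pi.single (0 : Fin d) (1 : ℝ) : Fin d → ℝ) k

/-- The increment of the exponent of the weight along the edge from `j` to `j + eₖ`. -/
noncomputable def edgePhase {d : ℕ} [NeZero d] (μ R t : ℝ) (k : Fin d) (j : Fin d → ℤ) : ℝ :=
  2 * μ * movedCoord R j t k + μ

/-- The time derivative of the exponent of the weight. -/
noncomputable def phaseRate {d : ℕ} [NeZero d] (ε μ R t : ℝ) (j : Fin d → ℤ) : ℝ :=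
  2 * μ * movedCoord R j t 0 * (R * (1 - 2 * t)) - (1 + ε) * R ^ 2 * (1 - 2 * t) / (16 * μ)

variable {d : ℕ} [NeZero d]

theorem movedCoord_add_single (R t : ℝ) (j : Fin d → ℤ) (k l : Fin d) :
    movedCoord R (j + Pi.single l 1) t k = movedCoord R j t k + if k = l then 1 else 0 := by
  by_cases h : k = l
  · subst h; simp [movedCoord]; ring
  · simp [movedCoord, h]

theorem edgePhase_add_single_self (μ R t : ℝ) (k : Fin d) (j : Fin d → ℤ) :
    edgePhase μ R t k (j + Pi.single k 1) = edgePhase μ R t k j + 2 * μ := by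
  simp [edgePhase, movedCoord_add_single]; ring

theorem edgePhase_add_single_of_ne (μ R t : ℝ) {k l : Fin d} (h : k ≠ l) (j : Fin d → ℤ) :
    edgePhase μ R t k (j + Pi.single l 1) = edgePhase μ R t k j := by
  simp [edgePhase, movedCoord_add_single, h]

theorem phaseRate_add_single_sub (ε μ R t : ℝ) (k : Fin d) (j : Fin d → ℤ) :
    phaseRate ε μ R t (j + Pi.single k 1) - phaseRate ε μ R t j =
      if k = 0 then 2 * μ * (R * (1 - 2 * t)) else 0 := by
  simp only [phaseRate, movedCoord_add_single, eq_comm (a := k)]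
  split_ifs <;> ring

theorem hasDerivAt_movedCoord (R t : ℝ) (j : Fin d → ℤ) (k : Fin d) :
    HasDerivAt (fun t => movedCoord R j t k) (if k = 0 then R * (1 - 2 * t) else 0) t := by
  have h : HasDerivAt (fun t : ℝ => R * t * (1 - t)) (R * (1 - 2 * t)) t := by
    have := ((hasDerivAt_id t).const_mul R).mul ((hasDerivAt_id t).const_sub 1)
    refine this.congr_deriv ?_
    simp; ring
  refine ((h.mul_const ((Pi.single (0 : Fin d) (1 : ℝ) : Fin d → ℝ) k)).const_add _).congr_deriv ?_
  by_cases hk : k = 0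
  · subst hk; simp
  · simp [hk]

theorem hasDerivAt_edgePhase (μ R t : ℝ) (j : Fin d → ℤ) (k : Fin d) :
    HasDerivAt (fun t => edgePhase μ R t k j) (if k = 0 then 2 * μ * (R * (1 - 2 * t)) else 0) t := by
  refine (((hasDerivAt_movedCoord R t j k).const_mul (2 * μ)).add_const μ).congr_deriv ?_
  split_ifs <;> simp

theorem hasDerivAt_phaseRate (ε μ R t : ℝ) (j : Fin d → ℤ) :
    HasDerivAt (fun t => phaseRate ε μ R t j)
      (2 * μ * (R * (1 - 2 * t)) ^ 2 - 4 * μ * R * movedCoord R j t 0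
        + (1 + ε) * R ^ 2 / (8 * μ)) t := by
  have h : HasDerivAt (fun t : ℝ => 1 - 2 * t) (-2) t := by
    simpa using ((hasDerivAt_id t).const_mul 2).const_sub 1
  refine ((((hasDerivAt_movedCoord R t j 0).const_mul (2 * μ)).mul (h.const_mul R)).sub
    ((h.const_mul ((1 + ε) * R ^ 2)).div_const (16 * μ))).congr_deriv ?_
  simp only [if_true]
  rcases eq_or_ne μ 0 with rfl | hμ
  · simp
  · field_simp; ring

/-- The integrand (at the site `j`) of the quadratic form of the symmetric part of the conjugated
operator. -/
noncomputable def symForm (ε μ R : ℝ) (f : (Fin d → ℤ) → ℝ → ℂ) (j : Fin d → ℤ) (t : ℝ) : ℝ :=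
  -(phaseRate ε μ R t j * ‖f j t‖ ^ 2) - ∑ k, 2 * (Real.sinh (edgePhase μ R t k j) *
    (conj (f j t) * f (j + Pi.single k 1) t).im)

/-- The time derivative of `symForm`, for a family with value `u` and time derivative `v`. -/
noncomputable def symFormRate (ε μ R : ℝ) (u v : (Fin d → ℤ) → ℂ) (j : Fin d → ℤ) (t : ℝ) : ℝ :=
  -((2 * μ * (R * (1 - 2 * t)) ^ 2 - 4 * μ * R * movedCoord R j t 0
      + (1 + ε) * R ^ 2 / (8 * μ)) * ‖u j‖ ^ 2 + phaseRate ε μ R t j * (2 * (conj (u j) * v j).re))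
    - ∑ k, 2 * ((Real.cosh (edgePhase μ R t k j) *
        (if k = 0 then 2 * μ * (R * (1 - 2 * t)) else 0)) * (conj (u j) * u (j + Pi.single k 1)).im
      + Real.sinh (edgePhase μ R t k j) * ((conj (v j) * u (j + Pi.single k 1)).im
        + (conj (u j) * v (j + Pi.single k 1)).im))

theorem hasDerivAt_symForm {ε μ R t : ℝ} {f : (Fin d → ℤ) → ℝ → ℂ} {v : (Fin d → ℤ) → ℂ}
    (hf : ∀ j, HasDerivAt (f j) (v j) t) (j : Fin d → ℤ) :
    HasDerivAt (symForm ε μ R f j) (symFormRate ε μ R (fun j => f j t) v j t) t := by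
  have hre : ∀ {g : ℝ → ℂ} {g' : ℂ}, HasDerivAt g g' t → HasDerivAt (fun t => (g t).re) g'.re t :=
    fun h => Complex.reCLM.hasFDerivAt.comp_hasDerivAt t h
  have him : ∀ {g : ℝ → ℂ} {g' : ℂ}, HasDerivAt g g' t → HasDerivAt (fun t => (g t).im) g'.im t :=
    fun h => Complex.imCLM.hasFDerivAt.comp_hasDerivAt t h
  have hconj : ∀ j, HasDerivAt (fun t => conj (f j t)) (conj (v j)) t := fun j =>
    Complex.conjCLE.toContinuousLinearMap.hasFDerivAt.comp_hasDerivAt t (hf j)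
  have hn : HasDerivAt (fun t => ‖f j t‖ ^ 2) (2 * (conj (f j t) * v j).re) t := by
    have := hre ((hconj j).mul (hf j))
    have e : (fun t => ‖f j t‖ ^ 2) = fun t => (conj (f j t) * f j t).re := by
      funext t
      rw [Complex.sq_norm, Complex.normSq_apply]; simp
    rw [e]
    refine this.congr_deriv ?_
    simp; ring
  exact ((hasDerivAt_phaseRate ε μ R t j).mul hn).neg.sub (HasDerivAt.fun_sum fun k _ =>
    (((hasDerivAt_edgePhase μ R t j k).sinh).mul
      (him ((hconj j).mul (hf (j + Pi.single k 1))))).const_mul 2) |>.congr_deriv (by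
        simp only [symFormRate, Complex.add_im, Pi.mul_apply])

/-- The conjugated operator dominates the rate of change of the quadratic form of its symmetric
part plus a large multiple of the square norm. -/
theorem sum_symFormRate_le {K : Finset (Fin d → ℤ)} {u v : (Fin d → ℤ) → ℂ}
    (hu : SupportedWithin K u) (hv : SupportedWithin K v) {μ R t : ℝ} (ε : ℝ) (hμ : 0 < μ)
    (hR : 0 ≤ R) (ht : t ∈ Set.Icc (0 : ℝ) 1)
    (hdiag : ∀ y : ℝ, 0 ≤ R ^ 2 / (8 * μ) +
      (4 * Real.sinh (2 * μ) - 8 * μ) * Real.sinh (2 * μ * y) ^ 2 - 4 * μ * R * y - 8 * μ * R) :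
    ∑ j ∈ K, symFormRate ε μ R u v j t ≤
      ∑ j ∈ K, ‖v j - Complex.I *
          ∑ k, (symHop (fun j => Real.cosh (edgePhase μ R t k j)) k u j - 2 * u j) +
        (-(phaseRate ε μ R t j * u j) + Complex.I *
          ∑ k, skewHop (fun j => Real.sinh (edgePhase μ R t k j)) k u j)‖ ^ 2
      - ε * R ^ 2 / (8 * μ) * ∑ j ∈ K, ‖u j‖ ^ 2 := by
  have h₁ := le_sum_sq_norm_conjugated hu hv hμ.le (phaseRate ε μ R t)
    (fun k j => edgePhase_add_single_self μ R t k j)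
    (fun k l j h => edgePhase_add_single_of_ne μ R t h j)
  have hX : 4 * |R * (1 - 2 * t)| ≤ 4 * R := by
    rw [abs_mul, abs_of_nonneg hR]
    have : |1 - 2 * t| ≤ 1 := abs_le.2 ⟨by linarith [ht.2], by linarith [ht.1]⟩
    nlinarith
  have h₂ := sum_edge_nonneg hu μ hX (edgePhase_add_single_self μ R t 0)
  have h₃ := mul_nonneg (show 0 ≤ 2 * μ by positivity) h₂
  refine le_sub_iff_add_le.2 (le_trans ?_ h₁)
  rw [← sub_nonneg]
  refine h₃.trans ?_
  rw [Finset.mul_sum, Finset.mul_sum, ← Finset.sum_add_distrib, ← Finset.sum_sub_distrib]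
  refine Finset.sum_le_sum fun j _ => ?_
  -- Only the direction of motion is needed; the other directions contribute nonnegative terms that
  -- are dropped.
  have h₄ : 4 * Real.sinh (2 * μ) * Real.sinh (edgePhase μ R t 0 j - μ) ^ 2 * ‖u j‖ ^ 2 ≤
      ∑ k, 4 * Real.sinh (2 * μ) * Real.sinh (edgePhase μ R t k j - μ) ^ 2 * ‖u j‖ ^ 2 := by
    have hs : 0 ≤ Real.sinh (2 * μ) := Real.sinh_nonneg_iff.2 (by positivity)
    exact Finset.single_le_sum
      (f := fun k => 4 * Real.sinh (2 * μ) * Real.sinh (edgePhase μ R t k j - μ) ^ 2 * ‖u j‖ ^ 2)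
      (fun k _ => by positivity) (Finset.mem_univ 0)
  have h₅ := mul_nonneg (hdiag (movedCoord R j t 0)) (sq_nonneg ‖u j‖)
  have e : edgePhase μ R t 0 j - μ = 2 * μ * movedCoord R j t 0 := by simp [edgePhase]
  simp only [symFormRate, phaseRate_add_single_sub, mul_ite, ite_mul, mul_zero, zero_mul,
    mul_add, Finset.sum_add_distrib, Finset.sum_ite_eq', Finset.mem_univ, if_true] at h₄ ⊢
  rw [e] at h₄ ⊢
  generalize ∑ k, 4 * Real.sinh (2 * μ) * Real.sinh (edgePhase μ R t k j - μ) ^ 2 * ‖u j‖ ^ 2 = S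
    at h₄ ⊢
  simp only [← Finset.mul_sum]
  linear_combination h₄ + h₅

end

/-! ### Finite supports, test functions and conjugation by the weight. -/

/-- Adding all nearest neighbours to `S` suffices. One `K` serves every `u`, hence all times and the
time derivative. -/
theorem exists_supportedWithin {d : ℕ} {S : Set (Fin d → ℤ)} (hS : S.Finite) :
    ∃ K : Finset (Fin d → ℤ), ∀ u : (Fin d → ℤ) → ℂ, (∀ j ∉ S, u j = 0) → SupportedWithin K u := by
  have hK : (S ∪ ((⋃ k : Fin d, (fun j => j + Pi.single k 1) ⁻¹' S) ∪
      ⋃ k : Fin d, (fun j => j - Pi.single k 1) ⁻¹' S)).Finite :=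
    hS.union ((Set.finite_iUnion fun k => hS.preimage (add_left_injective _).injOn).union
      (Set.finite_iUnion fun k => hS.preimage sub_left_injective.injOn))
  refine ⟨hK.toFinset, fun u hu => ⟨fun j hj => hu j ?_, fun j hj k => hu _ ?_,
    fun j hj k => hu _ ?_⟩⟩ <;>
  · simp only [Set.Finite.mem_toFinset, Set.mem_union, Set.mem_iUnion, Set.mem_preimage,
      not_or, not_exists] at hj
    first | exact hj.1 | exact hj.2.1 k | exact hj.2.2 k

namespace IsTestFunction

variable {d : ℕ} {g : (Fin d → ℤ) → ℝ → ℂ}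

theorem continuousOn (hg : IsTestFunction g) (j : Fin d → ℤ) :
    ContinuousOn (g j) (Set.Icc 0 1) :=
  (hg.smooth j).continuousOn

theorem continuousOn_derivWithin (hg : IsTestFunction g) (j : Fin d → ℤ) :
    ContinuousOn (derivWithin (g j) (Set.Icc 0 1)) (Set.Icc 0 1) :=
  (hg.smooth j).continuousOn_derivWithin (uniqueDiffOn_Icc zero_lt_one) (by simp)

theorem hasDerivAt (hg : IsTestFunction g) (j : Fin d → ℤ) {t : ℝ} (ht : t ∈ Set.Ioo (0 : ℝ) 1) :
    HasDerivAt (g j) (derivWithin (g j) (Set.Icc 0 1) t) t :=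
  (((hg.smooth j).differentiableOn (by simp) t
    (Set.Ioo_subset_Icc_self ht)).hasDerivWithinAt).hasDerivAt (Icc_mem_nhds ht.1 ht.2)

theorem continuousOn_schrodingerOp (hg : IsTestFunction g) (j : Fin d → ℤ) :
    ContinuousOn (schrodingerOp g j) (Set.Icc 0 1) := by
  unfold schrodingerOp discreteLaplacian
  refine (hg.continuousOn_derivWithin j).sub (continuousOn_const.mul
    (continuousOn_finsetSum _ fun k _ => ?_))
  exact ((hg.continuousOn _).sub (continuousOn_const.mul (hg.continuousOn _))).add
    (hg.continuousOn _)

end IsTestFunction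

variable {d : ℕ} [NeZero d]

theorem carlemanWeight_eq (ε μ R : ℝ) (j : Fin d → ℤ) (t : ℝ) :
    carlemanWeight ε μ R j t = Real.exp (μ * ∑ k, movedCoord R j t k ^ 2 -
      (1 + ε) * R ^ 2 * t * (1 - t) / (16 * μ)) := rfl

theorem carlemanWeight_add_single (ε μ R t : ℝ) (j : Fin d → ℤ) (k : Fin d) :
    carlemanWeight ε μ R (j + Pi.single k 1) t =
      Real.exp (edgePhase μ R t k j) * carlemanWeight ε μ R j t := by
  rw [carlemanWeight_eq, carlemanWeight_eq, ← Real.exp_add]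
  congr 1
  have h : ∀ l, movedCoord R (j + Pi.single k 1) t l ^ 2 = movedCoord R j t l ^ 2 +
      if l = k then 2 * movedCoord R j t k + 1 else 0 := fun l => by
    rw [movedCoord_add_single]
    split_ifs with hl
    · rw [hl]; ring
    · ring
  simp only [h, Finset.sum_add_distrib, Finset.sum_ite_eq', Finset.mem_univ, if_true, edgePhase]
  ring

theorem carlemanWeight_sub_single (ε μ R t : ℝ) (j : Fin d → ℤ) (k : Fin d) :
    Real.exp (edgePhase μ R t k (j - Pi.single k 1)) * carlemanWeight ε μ R (j - Pi.single k 1) t =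
      carlemanWeight ε μ R j t := by
  rw [← carlemanWeight_add_single, sub_add_cancel]

theorem hasDerivAt_carlemanWeight (ε μ R t : ℝ) (j : Fin d → ℤ) :
    HasDerivAt (carlemanWeight ε μ R j) (carlemanWeight ε μ R j t * phaseRate ε μ R t j) t := by
  have h₁ : HasDerivAt (fun t => ∑ k, movedCoord R j t k ^ 2)
      (∑ k, 2 * movedCoord R j t k * (if k = 0 then R * (1 - 2 * t) else 0)) t :=
    HasDerivAt.fun_sum fun k _ => by
      simpa using (hasDerivAt_movedCoord R t j k).fun_pow 2
  have h₂ : HasDerivAt (fun t : ℝ => (1 + ε) * R ^ 2 * t * (1 - t) / (16 * μ))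
      ((1 + ε) * R ^ 2 * (1 - 2 * t) / (16 * μ)) t := by
    refine ((((hasDerivAt_id t).const_mul ((1 + ε) * R ^ 2)).mul
      ((hasDerivAt_id t).const_sub 1)).div_const (16 * μ)).congr_deriv ?_
    simp; ring
  refine ((h₁.const_mul μ).sub h₂).exp.congr_deriv ?_
  simp [carlemanWeight_eq, phaseRate]
  ring

/-- Conjugation of the Schrödinger operator by the weight. -/
theorem carlemanWeight_mul_schrodingerOp (ε μ R : ℝ) (g : (Fin d → ℤ) → ℝ → ℂ) (j : Fin d → ℤ)
    (t : ℝ) :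
    (carlemanWeight ε μ R j t : ℂ) * schrodingerOp g j t =
      (carlemanWeight ε μ R j t * phaseRate ε μ R t j : ℝ) * g j t
        + carlemanWeight ε μ R j t * derivWithin (g j) (Set.Icc 0 1) t
      - Complex.I * ∑ k, (symHop (fun j => Real.cosh (edgePhase μ R t k j)) k
          (fun j => carlemanWeight ε μ R j t * g j t) j - 2 * (carlemanWeight ε μ R j t * g j t))
      + (-(phaseRate ε μ R t j * (carlemanWeight ε μ R j t * g j t)) + Complex.I *
          ∑ k, skewHop (fun j => Real.sinh (edgePhase μ R t k j)) k
            (fun j => carlemanWeight ε μ R j t * g j t) j) := by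
  have h : (carlemanWeight ε μ R j t : ℂ) * discreteLaplacian (fun m => g m t) j =
      ∑ k, (symHop (fun j => Real.cosh (edgePhase μ R t k j)) k
          (fun j => carlemanWeight ε μ R j t * g j t) j - 2 * (carlemanWeight ε μ R j t * g j t)) -
        ∑ k, skewHop (fun j => Real.sinh (edgePhase μ R t k j)) k
            (fun j => carlemanWeight ε μ R j t * g j t) j := by
    rw [discreteLaplacian, Finset.mul_sum, ← Finset.sum_sub_distrib]
    refine Finset.sum_congr rfl fun k _ => ?_
    -- The ratio of the weights across an edge is `exp(∓θ) = cosh θ ∓ sinh θ`, which splits the hop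
    -- into its symmetric and antisymmetric parts.
    have h₁ : carlemanWeight ε μ R j t = (Real.cosh (edgePhase μ R t k j) -
        Real.sinh (edgePhase μ R t k j)) * carlemanWeight ε μ R (j + Pi.single k 1) t := by
      rw [Real.cosh_sub_sinh, carlemanWeight_add_single, ← mul_assoc, ← Real.exp_add]
      simp
    have h₂ : carlemanWeight ε μ R j t = (Real.cosh (edgePhase μ R t k (j - Pi.single k 1)) +
        Real.sinh (edgePhase μ R t k (j - Pi.single k 1))) *
          carlemanWeight ε μ R (j - Pi.single k 1) t := by
      rw [Real.cosh_add_sinh, carlemanWeight_sub_single]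
    have h₁' := congrArg (Complex.ofReal) h₁
    have h₂' := congrArg (Complex.ofReal) h₂
    simp only [Complex.ofReal_mul, Complex.ofReal_sub, Complex.ofReal_add] at h₁' h₂'
    simp only [symHop, skewHop]
    linear_combination g (j + Pi.single k 1) t * h₁' + g (j - Pi.single k 1) t * h₂'
  rw [schrodingerOp, mul_sub, mul_left_comm, h]
  push_cast
  ring

theorem continuous_carlemanWeight (ε μ R : ℝ) (j : Fin d → ℤ) :
    Continuous (carlemanWeight ε μ R j) :=
  continuous_iff_continuousAt.2 fun t => (hasDerivAt_carlemanWeight ε μ R t j).continuousAt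

/-- This is `sum_symFormRate_le` with `u = W g` and `v` the product-rule derivative of `W g`. -/
theorem sum_symForm_deriv_le {g : (Fin d → ℤ) → ℝ → ℂ} {K : Finset (Fin d → ℤ)}
    (hK : ∀ t ∈ Set.Icc (0 : ℝ) 1, SupportedWithin K fun j => g j t)
    (hK' : ∀ t ∈ Set.Icc (0 : ℝ) 1, SupportedWithin K fun j => derivWithin (g j) (Set.Icc 0 1) t)
    {μ R t : ℝ} (ε : ℝ) (hμ : 0 < μ) (hR : 0 ≤ R) (ht : t ∈ Set.Icc (0 : ℝ) 1)
    (hdiag : ∀ y : ℝ, 0 ≤ R ^ 2 / (8 * μ) +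
      (4 * Real.sinh (2 * μ) - 8 * μ) * Real.sinh (2 * μ * y) ^ 2 - 4 * μ * R * y - 8 * μ * R) :
    ∑ j ∈ K, symFormRate ε μ R (fun j => carlemanWeight ε μ R j t * g j t)
        (fun j => (carlemanWeight ε μ R j t * phaseRate ε μ R t j : ℝ) * g j t
          + carlemanWeight ε μ R j t * derivWithin (g j) (Set.Icc 0 1) t) j t ≤
      ∑ j ∈ K, ‖(carlemanWeight ε μ R j t : ℂ) * schrodingerOp g j t‖ ^ 2 -
        ε * R ^ 2 / (8 * μ) * ∑ j ∈ K, ‖(carlemanWeight ε μ R j t : ℂ) * g j t‖ ^ 2 := by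
  have h := hK t ht
  have h' := hK' t ht
  refine (sum_symFormRate_le (K := K) ⟨?_, ?_, ?_⟩ ⟨?_, ?_, ?_⟩ ε hμ hR ht hdiag).trans_eq ?_
  · intro j hj; simp [h.self j hj]
  · intro j hj k; simp [h.right j hj k]
  · intro j hj k; simp [h.left j hj k]
  · intro j hj; simp [h.self j hj, h'.self j hj]
  · intro j hj k; simp [h.right j hj k, h'.right j hj k]
  · intro j hj k; simp [h.left j hj k, h'.left j hj k]
  · simp only [carlemanWeight_mul_schrodingerOp]

/-! ### Integration in time and the final estimate. -/

/-- The Carleman estimate for the square norms, for sums over a fixed finite set. -/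
theorem integral_sum_sq_le {g : (Fin d → ℤ) → ℝ → ℂ} (hg : IsTestFunction g)
    {K : Finset (Fin d → ℤ)}
    (hK : ∀ t ∈ Set.Icc (0 : ℝ) 1, SupportedWithin K fun j => g j t)
    (hK' : ∀ t ∈ Set.Icc (0 : ℝ) 1, SupportedWithin K fun j => derivWithin (g j) (Set.Icc 0 1) t)
    {μ R : ℝ} (ε : ℝ) (hμ : 0 < μ) (hR : 0 ≤ R)
    (hdiag : ∀ y : ℝ, 0 ≤ R ^ 2 / (8 * μ) +
      (4 * Real.sinh (2 * μ) - 8 * μ) * Real.sinh (2 * μ * y) ^ 2 - 4 * μ * R * y - 8 * μ * R) :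
    ε * R ^ 2 / (8 * μ) *
        ∫ t in (0 : ℝ)..1, ∑ j ∈ K, ‖(carlemanWeight ε μ R j t : ℂ) * g j t‖ ^ 2 ≤
      ∫ t in (0 : ℝ)..1, ∑ j ∈ K, ‖(carlemanWeight ε μ R j t : ℂ) * schrodingerOp g j t‖ ^ 2 := by
  have hw : ∀ j : Fin d → ℤ, Continuous fun t => (carlemanWeight ε μ R j t : ℂ) := fun j =>
    Complex.continuous_ofReal.comp (continuous_carlemanWeight ε μ R j)
  have hf : ∀ j, ContinuousOn (fun t => (carlemanWeight ε μ R j t : ℂ) * g j t) (Set.Icc 0 1) :=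
    fun j => (hw j).continuousOn.mul (hg.continuousOn j)
  have hH : ContinuousOn (fun t => ∑ j ∈ K, ‖(carlemanWeight ε μ R j t : ℂ) * g j t‖ ^ 2)
      (Set.Icc 0 1) := continuousOn_finsetSum _ fun j _ => (hf j).norm.pow 2
  have hG : ContinuousOn
      (fun t => ∑ j ∈ K, ‖(carlemanWeight ε μ R j t : ℂ) * schrodingerOp g j t‖ ^ 2)
      (Set.Icc 0 1) := continuousOn_finsetSum _ fun j _ =>
        (((hw j).continuousOn.mul (hg.continuousOn_schrodingerOp j)).norm.pow 2)
  set f : (Fin d → ℤ) → ℝ → ℂ := fun j t => carlemanWeight ε μ R j t * g j t with hf_def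
  have hB : ContinuousOn (fun t => ∑ j ∈ K, symForm ε μ R f j t) (Set.Icc 0 1) := by
    refine continuousOn_finsetSum _ fun j _ => ?_
    have hp : Continuous fun t => phaseRate ε μ R t j :=
      continuous_iff_continuousAt.2 fun t => (hasDerivAt_phaseRate ε μ R t j).continuousAt
    have hθ : ∀ k, Continuous fun t => edgePhase μ R t k j := fun k =>
      continuous_iff_continuousAt.2 fun t => (hasDerivAt_edgePhase μ R t j k).continuousAt
    refine (hp.continuousOn.mul ((hf j).norm.pow 2)).neg.sub
      (continuousOn_finsetSum _ fun k _ => continuousOn_const.mul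
        ((Real.continuous_sinh.comp (hθ k)).continuousOn.mul ?_))
    exact Complex.continuous_im.comp_continuousOn
      ((Complex.continuous_conj.comp_continuousOn (hf j)).mul (hf _))
  have hderiv : ∀ t ∈ Set.Ioo (0 : ℝ) 1, HasDerivAt (fun t => ∑ j ∈ K, symForm ε μ R f j t)
      (∑ j ∈ K, symFormRate ε μ R (fun j => f j t)
        (fun j => (carlemanWeight ε μ R j t * phaseRate ε μ R t j : ℝ) * g j t
          + carlemanWeight ε μ R j t * derivWithin (g j) (Set.Icc 0 1) t) j t) t := fun t ht =>
    HasDerivAt.fun_sum fun j _ => hasDerivAt_symForm (fun j =>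
      (hasDerivAt_carlemanWeight ε μ R t j).ofReal_comp.mul (hg.hasDerivAt j ht)) j
  -- This form of the fundamental theorem needs the derivative bound only inside the interval, with
  -- continuity up to the ends.
  have h := intervalIntegral.sub_le_integral_of_hasDeriv_right_of_le zero_le_one hB
    (fun t ht => (hderiv t ht).hasDerivWithinAt)
    ((hG.sub (continuousOn_const.mul hH)).integrableOn_Icc)
    (fun t ht => sum_symForm_deriv_le hK hK' ε hμ hR (Set.Ioo_subset_Icc_self ht) hdiag)
  have hGi := hG.intervalIntegrable_of_Icc (μ := MeasureTheory.volume) zero_le_one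
  have hHi := hH.intervalIntegrable_of_Icc (μ := MeasureTheory.volume) zero_le_one
  simp only [Pi.sub_apply, Pi.mul_apply] at h
  rw [intervalIntegral.integral_sub hGi (hHi.const_mul _), intervalIntegral.integral_const_mul] at h
  have h₀ : ∑ j ∈ K, symForm ε μ R f j 0 = 0 := by simp [symForm, hf_def, hg.zero_left]
  have h₁ : ∑ j ∈ K, symForm ε μ R f j 1 = 0 := by simp [symForm, hf_def, hg.zero_right]
  rw [h₀, h₁] at h
  linarith

/-- For families supported in a fixed finite set the norm is an integral of finite sums. -/
theorem normL2_eq_sqrt_integral_sum {d : ℕ} {F : (Fin d → ℤ) → ℝ → ℂ} {K : Finset (Fin d → ℤ)}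
    (h : ∀ t ∈ Set.Icc (0 : ℝ) 1, ∀ j ∉ K, F j t = 0) :
    normL2 F = √(∫ t in (0 : ℝ)..1, ∑ j ∈ K, ‖F j t‖ ^ 2) := by
  rw [normL2]
  congr 1
  refine intervalIntegral.integral_congr fun t ht => ?_
  rw [Set.uIcc_of_le zero_le_one] at ht
  exact tsum_eq_sum fun j hj => by simp [h t ht j hj]

end DiscreteCarleman

theorem lemma4p1 (d : ℕ) [NeZero d] (ε μ : ℝ) (hε : 0 < ε) (hμ : 0 < μ) :
    ∃ R₀ : ℝ, ∀ R : ℝ, R₀ ≤ R → ∀ g : (Fin d → ℤ) → ℝ → ℂ,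
      DiscreteCarleman.IsTestFunction g →
      R * Real.sqrt (ε / (8 * μ)) *
          DiscreteCarleman.normL2
            (fun j t => (DiscreteCarleman.carlemanWeight ε μ R j t : ℂ) * g j t) ≤
        DiscreteCarleman.normL2
          (fun j t => (DiscreteCarleman.carlemanWeight ε μ R j t : ℂ) *
            DiscreteCarleman.schrodingerOp g j t) := by
  obtain ⟨R₀, hR₀⟩ := DiscreteCarleman.exists_forall_diagonal_nonneg hμ
  refine ⟨R₀, fun R hR g hg => ?_⟩
  obtain ⟨hR, hdiag⟩ := hR₀ R hR
  obtain ⟨K, hK⟩ := DiscreteCarleman.exists_supportedWithin hg.finite_support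
  have hzero : ∀ j ∉ {j | ∃ t ∈ Set.Icc (0 : ℝ) 1, g j t ≠ 0}, ∀ t ∈ Set.Icc (0 : ℝ) 1,
      g j t = 0 := fun j hj t ht => by
    by_contra h
    exact hj ⟨t, ht, h⟩
  have h₁ : ∀ t ∈ Set.Icc (0 : ℝ) 1, DiscreteCarleman.SupportedWithin K fun j => g j t :=
    fun t ht => hK _ fun j hj => hzero j hj t ht
  have h₂ : ∀ t ∈ Set.Icc (0 : ℝ) 1,
      DiscreteCarleman.SupportedWithin K fun j => derivWithin (g j) (Set.Icc 0 1) t :=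
    fun t ht => hK _ fun j hj => by
      rw [derivWithin_congr (f := fun _ => 0) (hzero j hj) (hzero j hj t ht)]
      simp
  have h := DiscreteCarleman.integral_sum_sq_le hg h₁ h₂ ε hμ hR hdiag
  rw [DiscreteCarleman.normL2_eq_sqrt_integral_sum (K := K),
    DiscreteCarleman.normL2_eq_sqrt_integral_sum (K := K)]
  · refine le_trans (le_of_eq ?_) (Real.sqrt_le_sqrt h)
    rw [mul_div_right_comm, mul_comm (ε / (8 * μ)), Real.sqrt_mul (by positivity),
      Real.sqrt_mul (sq_nonneg R), Real.sqrt_sq hR]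
  · intro t ht j hj
    -- The margin of `K` is used here: no neighbour of a site outside `K` carries a value of `g`.
    have h₃ : DiscreteCarleman.discreteLaplacian (fun m => g m t) j = 0 :=
      Finset.sum_eq_zero fun k _ => by
        simp [(h₁ t ht).self j hj, (h₁ t ht).right j hj k, (h₁ t ht).left j hj k]
    rw [DiscreteCarleman.schrodingerOp, h₃, (h₂ t ht).self j hj]
    simp
  · intro t ht j hj
    simp [(h₁ t ht).self j hj]
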